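/- Let $\Delta\subset\mathbb{C}$ be the open unit disc, with Poincaré distance $\rho_\Delta(z,w)=\tanh^{-1}\left|\frac{z-w}{1-\overline{w}z}\right|$. For a domain (non-empty connected open set) $\Omega\subset\mathbb{C}^d$, let $K_\Omega(x,y)$ be the Kobayashi (pseudo-)distance, i.e. the infimum of $\sum_{i=1}^n\rho_\Delta(\zeta_{i-1},\zeta_i)$ over all $n\ge 1$, all holomorphic maps $\phi_1,\dots,\phi_n:\Delta\to\Omega$ and all $\zeta_0,\dots,\zeta_n\in\Delta$ with $\phi_1(\zeta_0)=x$, $\phi_n(\zeta_n)=y$ and $\phi_i(\zeta_i)=\phi_{i+1}(\zeta_i)$ for $1\le i\le n-1$; let $$k_\Omega(x;v)=\inf\{|a| : a\in\mathbb{C},\ f:\Delta\to\Omega \text{ holomorphic},\ f(0)=x,\ a f'(0)=v\}$$ be the Kobayashi--Royden (pseudo-)metric; and let $\delta_\Omega(x)$ be the Euclidean distance from $x$ to $\partial\Omega$. A bounded domain $\Omega\subset\mathbb{C}^d$ is called a *Goldilocks domain* if 1. for some $\epsilon>0$, $\int_0^\epsilon \frac1r M_\Omega(r)\,dr<\infty$,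 where $M_\Omega(r)=\sup\{1/k_\Omega(x;v) : x\in\Omega,\ \delta_\Omega(x)\le r,\ \|v\|=1\}$; and 2. for each $x_0\in\Omega$ there are constants $C,\alpha>0$ such that $K_\Omega(x_0,x)\le C+\alpha\log\frac{1}{\delta_\Omega(x)}$ for all $x\in\Omega$. For $x,y,o\in\Omega$ put $(x|y)_o^\Omega=\frac12\left(K_\Omega(x,o)+K_\Omega(o,y)-K_\Omega(x,y)\right)$. **Proposition.** Let $\Omega\subset\mathbb{C}^d$ be a Goldilocks domain, and let $(x_n)_{n\in\mathbb{N}}$, $(y_n)_{n\in\mathbb{N}}$ be sequences in $\Omega$ with $x_n\to\xi\in\partial\Omega$ and $y_n\to\eta\in\partial\Omega$, where $\xi\ne\eta$. Then, for every $o\in\Omega$, $$\limsup_{n,m\to\infty}\,(x_n|y_m)_o^\Omega<\infty .$$ -/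

import Mathlib

open Filter Topology

noncomputable section

/-- The Poincaré distance on the open unit disc of `ℂ`, with the normalization for which the
infinitesimal metric is `|dz| / (1 - |z|^2)`. -/
def poincareDist (z w : ℂ) : ℝ :=
  Real.artanh ‖(z - w) / (1 - (starRingEnd ℂ) w * z)‖

/-- `f` restricts to a holomorphic map from the open unit disc into `Ω`. -/
def IsDiscMap {d : ℕ} (Ω : Set (EuclideanSpace ℂ (Fin d)))
    (f : ℂ → EuclideanSpace ℂ (Fin d)) : Prop :=
  DifferentiableOn ℂ f (Metric.ball 0 1) ∧ Set.MapsTo f (Metric.ball 0 1) Ω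

/-- `φ 0, …, φ n` and `ζ 0, …, ζ (n + 1)` form an analytic chain in `Ω` (with `n + 1` discs)
joining `x` to `y`; the values of `φ` and `ζ` at larger indices play no role. -/
structure IsAnalyticChain {d : ℕ} (Ω : Set (EuclideanSpace ℂ (Fin d)))
    (x y : EuclideanSpace ℂ (Fin d)) (n : ℕ) (φ : ℕ → ℂ → EuclideanSpace ℂ (Fin d))
    (ζ : ℕ → ℂ) : Prop where
  isDiscMap : ∀ i ≤ n, IsDiscMap Ω (φ i)
  mem_disc : ∀ i ≤ n + 1, ζ i ∈ Metric.ball (0 : ℂ) 1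
  source : φ 0 (ζ 0) = x
  target : φ n (ζ (n + 1)) = y
  link : ∀ i < n, φ i (ζ (i + 1)) = φ (i + 1) (ζ (i + 1))

/-- The Kobayashi (pseudo-)distance: the infimum of the total Poincaré lengths of analytic chains
joining `x` to `y`. (Chains exist for all `x y ∈ Ω` when `Ω` is a domain.) -/
def kobayashiDist {d : ℕ} (Ω : Set (EuclideanSpace ℂ (Fin d)))
    (x y : EuclideanSpace ℂ (Fin d)) : ℝ :=
  sInf {L : ℝ | ∃ (n : ℕ) (φ : ℕ → ℂ → EuclideanSpace ℂ (Fin d)) (ζ : ℕ → ℂ),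
    IsAnalyticChain Ω x y n φ ζ ∧
      L = ∑ i ∈ Finset.range (n + 1), poincareDist (ζ i) (ζ (i + 1))}

/-- The Kobayashi–Royden (pseudo-)metric: the infimum of `|a|` over all `a ∈ ℂ` such that
`a f'(0) = v` for some holomorphic map `f` from the unit disc into `Ω` with `f(0) = x`. -/
def kobayashiMetric {d : ℕ} (Ω : Set (EuclideanSpace ℂ (Fin d)))
    (x v : EuclideanSpace ℂ (Fin d)) : ℝ :=
  sInf {t : ℝ | ∃ (f : ℂ → EuclideanSpace ℂ (Fin d)) (a : ℂ),
    IsDiscMap Ω f ∧ f 0 = x ∧ a • deriv f 0 = v ∧ t = ‖a‖}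

/-- The Euclidean distance to the boundary. -/
def boundaryDist {d : ℕ} (Ω : Set (EuclideanSpace ℂ (Fin d)))
    (x : EuclideanSpace ℂ (Fin d)) : ℝ :=
  Metric.infDist x (frontier Ω)

/-- `M_Ω(r) = sup {1 / k_Ω(x; v) : δ_Ω(x) ≤ r, ‖v‖ = 1}`. -/
def kobayashiGrowth {d : ℕ} (Ω : Set (EuclideanSpace ℂ (Fin d))) (r : ℝ) : ℝ :=
  sSup {s : ℝ | ∃ x ∈ Ω, ∃ v : EuclideanSpace ℂ (Fin d),
    boundaryDist Ω x ≤ r ∧ ‖v‖ = 1 ∧ s = 1 / kobayashiMetric Ω x v}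

/-- Goldilocks domains in `ℂ^d`. -/
structure IsGoldilocks {d : ℕ} (Ω : Set (EuclideanSpace ℂ (Fin d))) : Prop where
  isOpen : IsOpen Ω
  isConnected : IsConnected Ω
  isBounded : Bornology.IsBounded Ω
  integrable_growth : ∃ ε > 0,
    MeasureTheory.IntegrableOn (fun r : ℝ => 1 / r * kobayashiGrowth Ω r) (Set.Ioc 0 ε)
  dist_le : ∀ x₀ ∈ Ω, ∃ C > 0, ∃ α > 0, ∀ x ∈ Ω,
    kobayashiDist Ω x₀ x ≤ C + α * Real.log (1 / boundaryDist Ω x)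

/-- The Gromov product `(x|y)_o` with respect to a distance function `δ`. -/
def gromovProduct {X : Type*} (δ : X → X → ℝ) (x y o : X) : ℝ :=
  1 / 2 * (δ x o + δ o y - δ x y)

end

/-! This is a visibility argument. If `x` and `y` are at Euclidean distance at least `c`, a path
joining them that minimizes Kobayashi length up to an error `1` must meet a fixed region `{δ ≥ ε}`
(`IsGoldilocks.exists_le_boundaryDist`). Passing through that point bounds the Gromov product by the
distance from `o` to it, plus `1/2` (`IsGoldilocks.exists_gromovProduct_le`).

For visibility, let `T` be the time at which the path is farthest from the boundary. Near-minimality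
makes the Kobayashi distance from `γ T` at least `|t - T| - 1`, so the logarithmic upper bound
forces `δ ≤ A q ^ k` once `|t - T| ≥ k`, with `q < 1`. The Euclidean speed is at most `M(r)` where
`δ ≤ r`, so a path confined to `δ < ε` moves at most `2 ∑ M(min (A q ^ k) ε)`. The integral
condition makes `∑ M(A q ^ k)` converge (`summable_comp_geometric`), hence this is less than `c` for
small `ε`.

Suitable paths come directly from chains: each disc is run along a diameter at unit Poincaré speed
(`DiscChain.exists_isTamePath`). -/

noncomputable section

/-! ### Disc automorphisms and the Poincaré distance. -/

/-- The disc automorphism sending `a` to `0`. -/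
def moebius (a z : ℂ) : ℂ := (z - a) / (1 - (starRingEnd ℂ) a * z)

theorem poincareDist_eq (z w : ℂ) : poincareDist z w = Real.artanh ‖moebius w z‖ := rfl

theorem one_sub_conj_mul_ne_zero {a z : ℂ} (ha : ‖a‖ < 1) (hz : ‖z‖ < 1) :
    1 - (starRingEnd ℂ) a * z ≠ 0 := by
  intro h
  have h1 : (starRingEnd ℂ) a * z = 1 := (sub_eq_zero.mp h).symm
  have h2 : ‖a‖ * ‖z‖ = 1 := by
    rw [← RCLike.norm_conj a, ← norm_mul, h1, norm_one]
  nlinarith [norm_nonneg a, norm_nonneg z]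

theorem norm_moebius_lt_one {a z : ℂ} (ha : ‖a‖ < 1) (hz : ‖z‖ < 1) : ‖moebius a z‖ < 1 := by
  have hne := one_sub_conj_mul_ne_zero ha hz
  rw [moebius, norm_div, div_lt_one (norm_pos_iff.mpr hne)]
  refine lt_of_pow_lt_pow_left₀ 2 (norm_nonneg _) ?_
  rw [← Complex.normSq_eq_norm_sq, ← Complex.normSq_eq_norm_sq]
  have ha' : a.re ^ 2 + a.im ^ 2 < 1 := by
    have := Complex.normSq_eq_norm_sq a
    rw [Complex.normSq_apply] at this
    nlinarith [norm_nonneg a]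
  have hz' : z.re ^ 2 + z.im ^ 2 < 1 := by
    have := Complex.normSq_eq_norm_sq z
    rw [Complex.normSq_apply] at this
    nlinarith [norm_nonneg z]
  simp only [Complex.normSq_apply, Complex.sub_re, Complex.sub_im, Complex.mul_re, Complex.mul_im,
    Complex.conj_re, Complex.conj_im, Complex.one_re, Complex.one_im]
  -- The identity behind this is `|1 - āz|² - |z - a|² = (1 - |a|²)(1 - |z|²)`.
  nlinarith [mul_pos (sub_pos.mpr ha') (sub_pos.mpr hz')]

theorem mapsTo_moebius {a : ℂ} (ha : ‖a‖ < 1) :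
    Set.MapsTo (moebius a) (Metric.ball 0 1) (Metric.ball 0 1) := fun z hz => by
  rw [mem_ball_zero_iff] at *
  exact norm_moebius_lt_one ha hz

theorem differentiableOn_moebius {a : ℂ} (ha : ‖a‖ < 1) :
    DifferentiableOn ℂ (moebius a) (Metric.ball 0 1) := by
  refine DifferentiableOn.div (by fun_prop) (by fun_prop) fun z hz => ?_
  exact one_sub_conj_mul_ne_zero ha (mem_ball_zero_iff.mp hz)

theorem moebius_neg_moebius {a z : ℂ} (ha : ‖a‖ < 1) (hz : ‖z‖ < 1) :
    moebius (-a) (moebius a z) = z := by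
  have h1 := one_sub_conj_mul_ne_zero ha hz
  have h2 := one_sub_conj_mul_ne_zero ha ha
  have h3 := one_sub_conj_mul_ne_zero (a := -a) (by simpa using ha) (norm_moebius_lt_one ha hz)
  rw [moebius, div_eq_iff h3]
  simp only [moebius, map_neg]
  generalize (starRingEnd ℂ) a = c at *
  have h4 : 1 - z * c ≠ 0 := by rwa [mul_comm]
  field_simp
  ring

theorem moebius_moebius_neg {a z : ℂ} (ha : ‖a‖ < 1) (hz : ‖z‖ < 1) :
    moebius a (moebius (-a) z) = z := by
  simpa using moebius_neg_moebius (a := -a) (by simpa using ha) hz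

theorem moebius_self (a : ℂ) : moebius a a = 0 := by simp [moebius]

theorem moebius_neg_zero (a : ℂ) : moebius (-a) 0 = a := by simp [moebius]

theorem hasDerivAt_moebius_neg_zero (a : ℂ) :
    HasDerivAt (moebius (-a)) (1 - (starRingEnd ℂ) a * a) 0 := by
  have h := ((hasDerivAt_id (0 : ℂ)).sub_const (-a)).div
    (((hasDerivAt_id (0 : ℂ)).const_mul ((starRingEnd ℂ) (-a))).const_sub 1) (by simp)
  refine h.congr_deriv ?_
  simp
  ring

theorem norm_moebius_comm (a z : ℂ) : ‖moebius a z‖ = ‖moebius z a‖ := by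
  rw [moebius, moebius, norm_div, norm_div, norm_sub_rev]
  congr 1
  rw [← RCLike.norm_conj]
  simp [mul_comm]

theorem poincareDist_comm (z w : ℂ) : poincareDist z w = poincareDist w z := by
  rw [poincareDist_eq, poincareDist_eq, norm_moebius_comm]

theorem poincareDist_nonneg (z w : ℂ) : 0 ≤ poincareDist z w :=
  Real.artanh_nonneg (norm_nonneg _)

/-! ### Chains of discs and the Kobayashi distance. -/

variable {d : ℕ} {Ω : Set (EuclideanSpace ℂ (Fin d))} {x y z : EuclideanSpace ℂ (Fin d)}

theorem IsDiscMap.comp {f : ℂ → EuclideanSpace ℂ (Fin d)} (hf : IsDiscMap Ω f) {g : ℂ → ℂ}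
    (hg : DifferentiableOn ℂ g (Metric.ball 0 1))
    (hm : Set.MapsTo g (Metric.ball 0 1) (Metric.ball 0 1)) : IsDiscMap Ω (f ∘ g) :=
  ⟨hf.1.comp hg hm, hf.2.comp hm⟩

/-- `x` and `y` lie on a common disc in `Ω`, at Poincaré distance `ℓ`. -/
def DiscStep (Ω : Set (EuclideanSpace ℂ (Fin d))) (x y : EuclideanSpace ℂ (Fin d)) (ℓ : ℝ) :
    Prop :=
  ∃ f : ℂ → EuclideanSpace ℂ (Fin d), IsDiscMap Ω f ∧ ∃ z w : ℂ, ‖z‖ < 1 ∧ ‖w‖ < 1 ∧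
    f z = x ∧ f w = y ∧ poincareDist z w = ℓ

theorem DiscStep.symm {ℓ : ℝ} (h : DiscStep Ω x y ℓ) : DiscStep Ω y x ℓ := by
  obtain ⟨f, hf, z, w, hz, hw, hx, hy, hl⟩ := h
  exact ⟨f, hf, w, z, hw, hz, hy, hx, by rw [poincareDist_comm, hl]⟩

theorem DiscStep.nonneg {ℓ : ℝ} (h : DiscStep Ω x y ℓ) : 0 ≤ ℓ := by
  obtain ⟨f, hf, z, w, hz, hw, hx, hy, hl⟩ := h
  exact hl ▸ poincareDist_nonneg _ _

/-- The parameter of the second point of a step can be prescribed. -/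
theorem DiscStep.exists_target_eq {ℓ : ℝ} (h : DiscStep Ω x y ℓ) {w₀ : ℂ} (hw₀ : ‖w₀‖ < 1) :
    ∃ f : ℂ → EuclideanSpace ℂ (Fin d), IsDiscMap Ω f ∧ ∃ z : ℂ, ‖z‖ < 1 ∧
      f z = x ∧ f w₀ = y ∧ poincareDist z w₀ = ℓ := by
  obtain ⟨f, hf, z, w, hz, hw, hx, hy, hl⟩ := h
  have hw' : ‖-w‖ < 1 := by simpa using hw
  have hw₀' : ‖-w₀‖ < 1 := by simpa using hw₀
  have hzw := norm_moebius_lt_one hw hz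
  refine ⟨f ∘ (moebius (-w) ∘ moebius w₀), hf.comp
    ((differentiableOn_moebius hw').comp (differentiableOn_moebius hw₀) (mapsTo_moebius hw₀))
    ((mapsTo_moebius hw').comp (mapsTo_moebius hw₀)), moebius (-w₀) (moebius w z),
    norm_moebius_lt_one hw₀' hzw, ?_, ?_, ?_⟩
  · simp only [Function.comp_apply]
    rw [moebius_moebius_neg hw₀ hzw, moebius_neg_moebius hw hz, hx]
  · simp only [Function.comp_apply]
    rw [moebius_self, moebius_neg_zero, hy]
  · rw [poincareDist_eq, moebius_moebius_neg hw₀ hzw, ← poincareDist_eq, hl]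

/-- A step can be put in the normal form `0 ↦ x`, `tanh ℓ ↦ y`. -/
theorem DiscStep.exists_normal_form {ℓ : ℝ} (h : DiscStep Ω x y ℓ) :
    ∃ f : ℂ → EuclideanSpace ℂ (Fin d), IsDiscMap Ω f ∧ f 0 = x ∧ f (Real.tanh ℓ : ℝ) = y := by
  obtain ⟨f, hf, w, z, hw, hz, hx, hy, hl⟩ := h
  have hw' : ‖-w‖ < 1 := by simpa using hw
  have hzw := norm_moebius_lt_one hw hz
  obtain ⟨u, hu, huz⟩ : ∃ u : ℂ, ‖u‖ = 1 ∧ u * (‖moebius w z‖ : ℝ) = moebius w z := by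
    by_cases h0 : moebius w z = 0
    · exact ⟨1, by simp, by simp [h0]⟩
    · have h0' : ‖moebius w z‖ ≠ 0 := norm_ne_zero_iff.mpr h0
      refine ⟨moebius w z / ‖moebius w z‖, ?_, ?_⟩
      · rw [norm_div, Complex.norm_real, norm_norm, div_self h0']
      · rw [div_mul_cancel₀]
        exact_mod_cast h0'
  have hmul : Set.MapsTo (fun ζ => u * ζ) (Metric.ball (0 : ℂ) 1) (Metric.ball 0 1) :=
    fun ζ hζ => by
      rw [mem_ball_zero_iff] at *
      rwa [norm_mul, hu, one_mul]
  refine ⟨f ∘ (moebius (-w) ∘ fun ζ => u * ζ), hf.comp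
    ((differentiableOn_moebius hw').comp (by fun_prop) hmul)
    ((mapsTo_moebius hw').comp hmul), ?_, ?_⟩
  · simp [moebius_neg_zero, hx]
  · have ht : Real.tanh ℓ = ‖moebius w z‖ := by
      rw [← hl, poincareDist_comm, poincareDist_eq, Real.tanh_artanh]
      exact ⟨by linarith [norm_nonneg (moebius w z)], hzw⟩
    simp only [Function.comp_apply]
    rw [ht, huz, moebius_neg_moebius hw hz, hy]

/-- A finite chain of discs from `x` to `y` of total Poincaré length `L`. -/
inductive DiscChain (Ω : Set (EuclideanSpace ℂ (Fin d))) :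
    EuclideanSpace ℂ (Fin d) → EuclideanSpace ℂ (Fin d) → ℝ → Prop
  | single {x y ℓ} : DiscStep Ω x y ℓ → DiscChain Ω x y ℓ
  | cons {x y z ℓ L} : DiscStep Ω x y ℓ → DiscChain Ω y z L → DiscChain Ω x z (ℓ + L)

theorem DiscChain.trans {L M : ℝ} (h : DiscChain Ω x y L) (h' : DiscChain Ω y z M) :
    DiscChain Ω x z (L + M) := by
  induction h with
  | single hs => exact .cons hs h'
  | cons hs _ ih => rw [add_assoc]; exact .cons hs (ih h')

theorem DiscChain.symm {L : ℝ} (h : DiscChain Ω x y L) : DiscChain Ω y x L := by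
  induction h with
  | single hs => exact .single hs.symm
  | cons hs _ ih => rw [add_comm]; exact ih.trans (.single hs.symm)

theorem DiscChain.nonneg {L : ℝ} (h : DiscChain Ω x y L) : 0 ≤ L := by
  induction h with
  | single hs => exact hs.nonneg
  | cons hs _ ih => exact add_nonneg hs.nonneg ih

theorem IsAnalyticChain.discChain {n : ℕ} {φ : ℕ → ℂ → EuclideanSpace ℂ (Fin d)} {ζ : ℕ → ℂ}
    (h : IsAnalyticChain Ω x y n φ ζ) :
    DiscChain Ω x y (∑ i ∈ Finset.range (n + 1), poincareDist (ζ i) (ζ (i + 1))) := by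
  induction n generalizing x φ ζ with
  | zero =>
    rw [zero_add, Finset.sum_range_one]
    exact .single ⟨φ 0, h.isDiscMap 0 le_rfl, ζ 0, ζ 1,
      mem_ball_zero_iff.mp (h.mem_disc 0 (by simp)), mem_ball_zero_iff.mp (h.mem_disc 1 (by simp)), h.source, h.target, rfl⟩
  | succ n ih =>
    rw [Finset.sum_range_succ', add_comm]
    refine .cons (y := φ 0 (ζ 1)) ⟨φ 0, h.isDiscMap 0 (by simp), ζ 0, ζ 1,
      mem_ball_zero_iff.mp (h.mem_disc 0 (by simp)),
      mem_ball_zero_iff.mp (h.mem_disc 1 (by simp)), h.source, rfl, rfl⟩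
      (ih (φ := fun i => φ (i + 1)) (ζ := fun i => ζ (i + 1))
        ⟨fun i hi => ?_, fun i hi => ?_, ?_, ?_, fun i hi => ?_⟩)
    · exact h.isDiscMap _ (by omega)
    · exact h.mem_disc _ (by omega)
    · exact (h.link 0 (by omega)).symm
    · exact h.target
    · exact h.link (i + 1) (by omega)

theorem DiscChain.exists_isAnalyticChain {L : ℝ} (h : DiscChain Ω x y L) :
    ∃ (n : ℕ) (φ : ℕ → ℂ → EuclideanSpace ℂ (Fin d)) (ζ : ℕ → ℂ),
      IsAnalyticChain Ω x y n φ ζ ∧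
        L = ∑ i ∈ Finset.range (n + 1), poincareDist (ζ i) (ζ (i + 1)) := by
  induction h with
  | single hs =>
    obtain ⟨f, hf, z, w, hz, hw, hx, hy, hl⟩ := hs
    refine ⟨0, fun _ => f, fun i => if i = 0 then z else w, ⟨fun _ _ => hf, fun i _ => ?_, ?_, ?_,
      fun i hi => absurd hi (by omega)⟩, ?_⟩
    · rw [mem_ball_zero_iff]
      split_ifs <;> assumption
    · simpa using hx
    · simpa using hy
    · simpa using hl.symm
  | cons hs _ ih =>
    obtain ⟨n, φ, ζ, hc, rfl⟩ := ih
    -- Analytic chains require consecutive discs to meet at the same parameter, so the new disc is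
    -- reparametrized to reach its endpoint at `ζ 0`.
    obtain ⟨f, hf, z, hz, hx, hy, hl⟩ :=
      hs.exists_target_eq (mem_ball_zero_iff.mp (hc.mem_disc 0 (by simp)))
    refine ⟨n + 1, fun i => Nat.casesOn i f φ, fun i => Nat.casesOn i z ζ,
      ⟨?_, ?_, hx, hc.target, ?_⟩, ?_⟩
    · rintro (_ | i) hi
      · exact hf
      · exact hc.isDiscMap i (by omega)
    · rintro (_ | i) hi
      · exact mem_ball_zero_iff.mpr hz
      · exact hc.mem_disc i (by omega)
    · rintro (_ | i) hi
      · exact hy.trans hc.source.symm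
      · exact hc.link i (by omega)
    · rw [Finset.sum_range_succ' _ (n + 1), add_comm, ← hl]
      rfl

theorem kobayashiDist_eq_sInf (Ω : Set (EuclideanSpace ℂ (Fin d)))
    (x y : EuclideanSpace ℂ (Fin d)) :
    kobayashiDist Ω x y = sInf {L : ℝ | DiscChain Ω x y L} := by
  rw [kobayashiDist]
  congr 1
  ext L
  constructor
  · rintro ⟨n, φ, ζ, hc, rfl⟩
    exact hc.discChain
  · exact fun h => h.exists_isAnalyticChain

theorem kobayashiDist_comm (Ω : Set (EuclideanSpace ℂ (Fin d)))
    (x y : EuclideanSpace ℂ (Fin d)) : kobayashiDist Ω x y = kobayashiDist Ω y x := by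
  rw [kobayashiDist_eq_sInf, kobayashiDist_eq_sInf]
  congr 1
  ext L
  exact ⟨DiscChain.symm, DiscChain.symm⟩

theorem DiscChain.kobayashiDist_le {L : ℝ} (h : DiscChain Ω x y L) : kobayashiDist Ω x y ≤ L := by
  rw [kobayashiDist_eq_sInf]
  exact csInf_le ⟨0, fun M hM => DiscChain.nonneg hM⟩ h

/-- Nearby points lie on an affine disc, and connectedness does the rest. This keeps the infimum
away from the default value `sInf ∅ = 0`. -/
theorem exists_discChain (ho : IsOpen Ω) (hc : IsPreconnected Ω) (hx : x ∈ Ω) (hy : y ∈ Ω) :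
    ∃ L, DiscChain Ω x y L := by
  refine hc.induction₂ (fun x y => ∃ L, DiscChain Ω x y L) (fun x hx => ?_)
    (fun x y z _ _ _ ⟨L, h⟩ ⟨M, h'⟩ => ⟨L + M, h.trans h'⟩)
    (fun x y _ _ ⟨L, h⟩ => ⟨L, h.symm⟩) hx hy
  obtain ⟨ε, hε, hball⟩ := Metric.isOpen_iff.mp ho x hx
  refine mem_nhdsWithin_of_mem_nhds ?_
  filter_upwards [Metric.ball_mem_nhds x (half_pos hε)] with y hy
  refine ⟨_, .single ⟨fun ζ => x + (2 * ζ) • (y - x), ⟨by fun_prop, fun ζ hζ => hball ?_⟩, 0, 1 / 2,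
    by simp, by norm_num, by simp, by simp, rfl⟩⟩
  rw [mem_ball_zero_iff] at hζ
  rw [mem_ball_iff_norm] at *
  rw [add_sub_cancel_left, norm_smul, norm_mul, Complex.norm_two]
  nlinarith [norm_nonneg (y - x)]

theorem exists_discChain_lt (ho : IsOpen Ω) (hc : IsPreconnected Ω) (hx : x ∈ Ω) (hy : y ∈ Ω)
    {c : ℝ} (h : kobayashiDist Ω x y < c) : ∃ L < c, DiscChain Ω x y L := by
  rw [kobayashiDist_eq_sInf] at h
  obtain ⟨L, hL, hlt⟩ := exists_lt_of_csInf_lt (exists_discChain ho hc hx hy) h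
  exact ⟨L, hlt, hL⟩

theorem kobayashiDist_triangle (ho : IsOpen Ω) (hc : IsPreconnected Ω) (hx : x ∈ Ω) (hy : y ∈ Ω)
    (hz : z ∈ Ω) : kobayashiDist Ω x z ≤ kobayashiDist Ω x y + kobayashiDist Ω y z := by
  refine le_of_forall_pos_le_add fun ε hε => ?_
  obtain ⟨L, hL, h⟩ := exists_discChain_lt ho hc hx hy (lt_add_of_pos_right _ (half_pos hε))
  obtain ⟨M, hM, h'⟩ := exists_discChain_lt ho hc hy hz (lt_add_of_pos_right _ (half_pos hε))
  linarith [(h.trans h').kobayashiDist_le]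

/-! ### The Kobayashi–Royden metric and its growth function. -/

theorem exists_norm_deriv_le (hb : Bornology.IsBounded Ω) :
    ∃ R > 0, ∀ f : ℂ → EuclideanSpace ℂ (Fin d), IsDiscMap Ω f → ‖deriv f 0‖ ≤ R := by
  obtain ⟨C, hC⟩ := Metric.isBounded_iff.mp hb
  refine ⟨max C 1, by positivity, fun f hf => ?_⟩
  have := Complex.norm_deriv_le_div_of_mapsTo_ball (R₂ := max C 1) hf.1
    (fun z hz => ?_) one_pos
  · simpa using this
  · exact Metric.mem_closedBall.mpr
      ((hC (hf.2 hz) (hf.2 (Metric.mem_ball_self one_pos))).trans (le_max_left _ _))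

theorem kobayashiMetric_nonneg (x v : EuclideanSpace ℂ (Fin d)) : 0 ≤ kobayashiMetric Ω x v :=
  Real.sInf_nonneg fun _ ⟨_, _, _, _, _, ht⟩ => ht ▸ norm_nonneg _

theorem le_kobayashiMetric {R : ℝ} (hR : 0 < R)
    (h : ∀ f : ℂ → EuclideanSpace ℂ (Fin d), IsDiscMap Ω f → ‖deriv f 0‖ ≤ R)
    {v : EuclideanSpace ℂ (Fin d)}
    (hne : {t : ℝ | ∃ (f : ℂ → EuclideanSpace ℂ (Fin d)) (a : ℂ),
      IsDiscMap Ω f ∧ f 0 = x ∧ a • deriv f 0 = v ∧ t = ‖a‖}.Nonempty) :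
    ‖v‖ / R ≤ kobayashiMetric Ω x v := by
  refine le_csInf hne ?_
  rintro t ⟨f, a, hf, -, rfl, rfl⟩
  rw [norm_smul, div_le_iff₀ hR]
  exact mul_le_mul_of_nonneg_left (h f hf) (norm_nonneg _)

theorem bddAbove_growthSet (hb : Bornology.IsBounded Ω) (r : ℝ) :
    BddAbove {s : ℝ | ∃ x ∈ Ω, ∃ v : EuclideanSpace ℂ (Fin d),
      boundaryDist Ω x ≤ r ∧ ‖v‖ = 1 ∧ s = 1 / kobayashiMetric Ω x v} := by
  obtain ⟨R, hR, h⟩ := exists_norm_deriv_le hb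
  refine ⟨R, ?_⟩
  rintro s ⟨x, hx, v, -, hv, rfl⟩
  rcases Set.eq_empty_or_nonempty {t : ℝ | ∃ (f : ℂ → EuclideanSpace ℂ (Fin d)) (a : ℂ),
      IsDiscMap Ω f ∧ f 0 = x ∧ a • deriv f 0 = v ∧ t = ‖a‖} with he | hne
  -- Without competing discs the metric takes the default value `0`, and `1 / 0 = 0`.
  · rw [kobayashiMetric, he, Real.sInf_empty, div_zero]
    exact hR.le
  · have := le_kobayashiMetric hR h hne
    rw [hv] at this
    exact (one_div_le hR (lt_of_lt_of_le (by positivity) this)).mp this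

theorem kobayashiGrowth_nonneg (r : ℝ) : 0 ≤ kobayashiGrowth Ω r := by
  refine Real.sSup_nonneg ?_
  rintro s ⟨x, hx, v, -, hv, rfl⟩
  exact one_div_nonneg.mpr (kobayashiMetric_nonneg _ _)

/-- The disc `f` itself competes for the unit vector `v` along `f'(0)`, giving `k(f 0; v) ≤ 1 /
‖f'(0)‖`. Boundedness of `Ω` gives `k > 0`, so that inverting is legitimate, and makes the supremum
a genuine one. -/
theorem norm_deriv_le_kobayashiGrowth (hb : Bornology.IsBounded Ω)
    {f : ℂ → EuclideanSpace ℂ (Fin d)} (hf : IsDiscMap Ω f) {r : ℝ}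
    (hr : boundaryDist Ω (f 0) ≤ r) : ‖deriv f 0‖ ≤ kobayashiGrowth Ω r := by
  by_cases h0 : deriv f 0 = 0
  · rw [h0, norm_zero]
    exact kobayashiGrowth_nonneg r
  · have hpos : 0 < ‖deriv f 0‖ := norm_pos_iff.mpr h0
    set v : EuclideanSpace ℂ (Fin d) := ((‖deriv f 0‖⁻¹ : ℝ) : ℂ) • deriv f 0 with hv
    have hnorm : ‖((‖deriv f 0‖⁻¹ : ℝ) : ℂ)‖ = ‖deriv f 0‖⁻¹ := by
      rw [Complex.norm_real, norm_inv, norm_norm]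
    have hv1 : ‖v‖ = 1 := by rw [hv, norm_smul, hnorm, inv_mul_cancel₀ hpos.ne']
    have hmem : ‖deriv f 0‖⁻¹ ∈ {t : ℝ | ∃ (g : ℂ → EuclideanSpace ℂ (Fin d)) (a : ℂ),
        IsDiscMap Ω g ∧ g 0 = f 0 ∧ a • deriv g 0 = v ∧ t = ‖a‖} :=
      ⟨f, _, hf, rfl, rfl, hnorm.symm⟩
    obtain ⟨R, hR, h⟩ := exists_norm_deriv_le hb
    have h1 := le_kobayashiMetric hR h ⟨_, hmem⟩
    rw [hv1] at h1
    have h2 : kobayashiMetric Ω (f 0) v ≤ ‖deriv f 0‖⁻¹ :=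
      csInf_le ⟨0, fun t ⟨_, _, _, _, _, ht⟩ => ht ▸ norm_nonneg _⟩ hmem
    have h3 : 0 < kobayashiMetric Ω (f 0) v := lt_of_lt_of_le (by positivity) h1
    calc ‖deriv f 0‖ ≤ 1 / kobayashiMetric Ω (f 0) v := by
          rw [le_div_iff₀ h3]
          calc _ ≤ ‖deriv f 0‖ * ‖deriv f 0‖⁻¹ := by gcongr
            _ = 1 := mul_inv_cancel₀ hpos.ne'
      _ ≤ _ := le_csSup (bddAbove_growthSet hb r)
          ⟨f 0, hf.2 (Metric.mem_ball_self one_pos), v, hr, hv1, rfl⟩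

theorem kobayashiGrowth_mono (hb : Bornology.IsBounded Ω) : Monotone (kobayashiGrowth Ω) := by
  intro r r' hr
  refine Real.sSup_le ?_ (kobayashiGrowth_nonneg _)
  rintro s ⟨x, hx, v, hxr, hv, rfl⟩
  exact le_csSup (bddAbove_growthSet hb r') ⟨x, hx, v, hxr.trans hr, hv, rfl⟩

/-! ### Paths traced along chains of discs. -/

theorem hasDerivAt_tanh (s : ℝ) : HasDerivAt Real.tanh (1 - Real.tanh s ^ 2) s := by
  have h := (Real.hasDerivAt_sinh s).div (Real.hasDerivAt_cosh s) (Real.cosh_pos s).ne'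
  have he : Real.tanh = Real.sinh / Real.cosh := by
    ext t
    exact Real.tanh_eq_sinh_div_cosh t
  rw [he]
  refine h.congr_deriv ?_
  have := (Real.cosh_pos s).ne'
  simp only [Pi.div_apply]
  field_simp

theorem norm_tanh_lt_one (s : ℝ) : ‖((Real.tanh s : ℝ) : ℂ)‖ < 1 := by
  rw [Complex.norm_real, Real.norm_eq_abs]
  exact Real.abs_tanh_lt_one s

theorem poincareDist_tanh {s t : ℝ} (hst : s ≤ t) :
    poincareDist (Real.tanh s : ℝ) (Real.tanh t : ℝ) = t - s := by
  have hs := Real.cosh_pos s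
  have ht := Real.cosh_pos t
  have hts := Real.cosh_pos (t - s)
  have key : (Real.tanh t - Real.tanh s) / (1 - Real.tanh s * Real.tanh t) =
      Real.tanh (t - s) := by
    rw [Real.tanh_eq_sinh_div_cosh, Real.tanh_eq_sinh_div_cosh, Real.tanh_eq_sinh_div_cosh,
      Real.sinh_sub, Real.cosh_sub]
    rw [Real.cosh_sub] at hts
    have h1 : 1 - Real.sinh s / Real.cosh s * (Real.sinh t / Real.cosh t) ≠ 0 := by
      have : 1 - Real.sinh s / Real.cosh s * (Real.sinh t / Real.cosh t) =
          (Real.cosh t * Real.cosh s - Real.sinh t * Real.sinh s) / (Real.cosh t * Real.cosh s) := by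
        field_simp
      rw [this]
      positivity
    rw [div_eq_div_iff h1 hts.ne']
    field_simp
  rw [poincareDist_comm, poincareDist_eq, moebius, Complex.conj_ofReal]
  have : (((Real.tanh t : ℝ) : ℂ) - (Real.tanh s : ℝ)) /
      (1 - (Real.tanh s : ℝ) * (Real.tanh t : ℝ)) = ((Real.tanh (t - s) : ℝ) : ℂ) := by
    rw [← key]; push_cast; rfl
  rw [this, Complex.norm_real, Real.norm_of_nonneg, Real.artanh_tanh]
  rw [Real.tanh_eq_sinh_div_cosh]
  exact div_nonneg (Real.sinh_nonneg_iff.mpr (sub_nonneg.mpr hst)) hts.le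

/-- `γ` on `[0, L]` joins `x` to `y` in `Ω`, is `1`-Lipschitz for the Kobayashi distance, and its
Euclidean speed is controlled by `kobayashiGrowth`. -/
structure IsTamePath (Ω : Set (EuclideanSpace ℂ (Fin d))) (x y : EuclideanSpace ℂ (Fin d)) (L : ℝ)
    (γ : ℝ → EuclideanSpace ℂ (Fin d)) : Prop where
  nonneg : 0 ≤ L
  source : γ 0 = x
  target : γ L = y
  mem : ∀ t, 0 ≤ t → t ≤ L → γ t ∈ Ω
  dist_le : ∀ s t, 0 ≤ s → s ≤ t → t ≤ L → kobayashiDist Ω (γ s) (γ t) ≤ t - s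
  speed : ∀ s t r, 0 ≤ s → s ≤ t → t ≤ L → (∀ u, s ≤ u → u ≤ t → boundaryDist Ω (γ u) ≤ r) →
    ‖γ t - γ s‖ ≤ kobayashiGrowth Ω r * (t - s)

theorem DiscStep.exists_isTamePath (hb : Bornology.IsBounded Ω) {ℓ : ℝ} (h : DiscStep Ω x y ℓ) :
    ∃ γ, IsTamePath Ω x y ℓ γ := by
  obtain ⟨f, hf, hx, hy⟩ := h.exists_normal_form
  refine ⟨fun s => f (Real.tanh s : ℝ), h.nonneg, by simpa using hx, hy,
    fun t _ _ => hf.2 (mem_ball_zero_iff.mpr (norm_tanh_lt_one t)), fun s t _ hst _ =>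
      (DiscChain.single ⟨f, hf, _, _, norm_tanh_lt_one s, norm_tanh_lt_one t, rfl, rfl,
        poincareDist_tanh hst⟩).kobayashiDist_le, fun s t r _ hst _ hr => ?_⟩
  have hder : ∀ u : ℝ, HasDerivAt (fun s : ℝ => f (Real.tanh s : ℝ))
      (((1 - Real.tanh u ^ 2 : ℝ) : ℂ) • deriv f (Real.tanh u : ℝ)) u := fun u => by
    have h1 : HasDerivAt f (deriv f (Real.tanh u : ℝ)) ((Real.tanh u : ℝ) : ℂ) :=
      (hf.1.differentiableAt (Metric.isOpen_ball.mem_nhds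
        (mem_ball_zero_iff.mpr (norm_tanh_lt_one u)))).hasDerivAt
    have h2 : HasDerivAt (fun s : ℝ => ((Real.tanh s : ℝ) : ℂ)) ((1 - Real.tanh u ^ 2 : ℝ) : ℂ) u :=
      (hasDerivAt_tanh u).ofReal_comp
    exact HasDerivAt.scomp (h := fun s : ℝ => ((Real.tanh s : ℝ) : ℂ)) u h1 h2
  -- With `a = tanh u`, the velocity is the derivative at `0` of `f ∘ moebius (-a)`, a disc centred
  -- at `f a`; hence the growth function bounds it.
  have hbound : ∀ u ∈ Set.Icc s t,
      ‖((1 - Real.tanh u ^ 2 : ℝ) : ℂ) • deriv f (Real.tanh u : ℝ)‖ ≤ kobayashiGrowth Ω r := by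
    intro u hu
    set a : ℂ := ((Real.tanh u : ℝ) : ℂ) with ha
    have ha1 : ‖a‖ < 1 := norm_tanh_lt_one u
    have ha1' : ‖-a‖ < 1 := by simpa using ha1
    have h1 : HasDerivAt f (deriv f a) (moebius (-a) 0) := by
      rw [moebius_neg_zero]
      exact (hf.1.differentiableAt (Metric.isOpen_ball.mem_nhds
        (mem_ball_zero_iff.mpr ha1))).hasDerivAt
    have h2 := HasDerivAt.scomp (0 : ℂ) h1 (hasDerivAt_moebius_neg_zero a)
    have h3 : 1 - (starRingEnd ℂ) a * a = ((1 - Real.tanh u ^ 2 : ℝ) : ℂ) := by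
      rw [ha, Complex.conj_ofReal]; push_cast; ring
    rw [h3] at h2
    rw [← h2.deriv]
    refine norm_deriv_le_kobayashiGrowth hb
      (hf.comp (differentiableOn_moebius ha1') (mapsTo_moebius ha1')) ?_
    rw [Function.comp_apply, moebius_neg_zero]
    exact hr u hu.1 hu.2
  have := (convex_Icc s t).norm_image_sub_le_of_norm_hasDerivWithin_le
    (fun u _ => (hder u).hasDerivWithinAt) hbound (Set.left_mem_Icc.mpr hst)
    (Set.right_mem_Icc.mpr hst)
  rwa [Real.norm_of_nonneg (sub_nonneg.mpr hst)] at this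

theorem IsTamePath.trans (ho : IsOpen Ω) (hc : IsPreconnected Ω) {L M : ℝ}
    {γ γ' : ℝ → EuclideanSpace ℂ (Fin d)} (h : IsTamePath Ω x y L γ) (h' : IsTamePath Ω y z M γ') :
    ∃ σ, IsTamePath Ω x z (L + M) σ := by
  have hL := h.nonneg
  have hM := h'.nonneg
  set σ : ℝ → EuclideanSpace ℂ (Fin d) := fun t => if t ≤ L then γ t else γ' (t - L)
  have hl : ∀ t, t ≤ L → σ t = γ t := fun t ht => if_pos ht
  have hr : ∀ t, L ≤ t → σ t = γ' (t - L) := fun t ht => by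
    rcases ht.eq_or_lt with rfl | hlt
    · rw [hl _ le_rfl, h.target, sub_self, h'.source]
    · exact if_neg (not_le.mpr hlt)
  have hmem : ∀ t, 0 ≤ t → t ≤ L + M → σ t ∈ Ω := fun t h0 h1 => by
    rcases le_total t L with htL | htL
    · rw [hl t htL]; exact h.mem t h0 htL
    · rw [hr t htL]; exact h'.mem _ (by linarith) (by linarith)
  refine ⟨σ, add_nonneg hL hM, (hl 0 hL).trans h.source, ?_, hmem, ?_, ?_⟩
  · rw [hr _ (by linarith), add_sub_cancel_left, h'.target]
  · have h1 : ∀ s t, 0 ≤ s → s ≤ t → t ≤ L → kobayashiDist Ω (σ s) (σ t) ≤ t - s :=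
      fun s t hs hst ht => by
        rw [hl s (hst.trans ht), hl t ht]; exact h.dist_le s t hs hst ht
    have h2 : ∀ s t, L ≤ s → s ≤ t → t ≤ L + M → kobayashiDist Ω (σ s) (σ t) ≤ t - s :=
      fun s t hs hst ht => by
        rw [hr s hs, hr t (hs.trans hst)]
        exact (h'.dist_le (s - L) (t - L) (by linarith) (by linarith) (by linarith)).trans_eq
          (by ring)
    intro s t hs hst ht
    rcases le_total t L with htL | htL
    · exact h1 s t hs hst htL
    rcases le_total L s with hsL | hsL
    · exact h2 s t hsL hst ht
    linarith [h1 s L hs hsL le_rfl, h2 L t le_rfl htL ht,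
      kobayashiDist_triangle ho hc (hmem s hs (by linarith)) (hmem L hL (by linarith))
        (hmem t (by linarith) ht)]
  · have h1 : ∀ s t r, 0 ≤ s → s ≤ t → t ≤ L →
        (∀ u, s ≤ u → u ≤ t → boundaryDist Ω (σ u) ≤ r) →
        ‖σ t - σ s‖ ≤ kobayashiGrowth Ω r * (t - s) := fun s t r hs hst ht hu => by
      rw [hl s (hst.trans ht), hl t ht]
      refine h.speed s t r hs hst ht fun u hsu hut => ?_
      rw [← hl u (hut.trans ht)]
      exact hu u hsu hut
    have h2 : ∀ s t r, L ≤ s → s ≤ t → t ≤ L + M →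
        (∀ u, s ≤ u → u ≤ t → boundaryDist Ω (σ u) ≤ r) →
        ‖σ t - σ s‖ ≤ kobayashiGrowth Ω r * (t - s) := fun s t r hs hst ht hu => by
      rw [hr s hs, hr t (hs.trans hst)]
      refine (h'.speed (s - L) (t - L) r (by linarith) (by linarith) (by linarith)
        fun u hsu hut => ?_).trans_eq (by ring)
      have := hu (u + L) (by linarith) (by linarith)
      rwa [hr _ (by linarith), add_sub_cancel_right] at this
    intro s t r hs hst ht hu
    rcases le_total t L with htL | htL
    · exact h1 s t r hs hst htL hu
    rcases le_total L s with hsL | hsL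
    · exact h2 s t r hsL hst ht hu
    calc ‖σ t - σ s‖ ≤ ‖σ t - σ L‖ + ‖σ L - σ s‖ := norm_sub_le_norm_sub_add_norm_sub _ _ _
      _ ≤ kobayashiGrowth Ω r * (t - L) + kobayashiGrowth Ω r * (L - s) :=
        add_le_add (h2 L t r le_rfl htL ht fun u h3 h4 => hu u (hsL.trans h3) h4)
          (h1 s L r hs hsL le_rfl fun u h3 h4 => hu u h3 (h4.trans htL))
      _ = _ := by ring

theorem DiscChain.exists_isTamePath (ho : IsOpen Ω) (hc : IsPreconnected Ω)
    (hb : Bornology.IsBounded Ω) {L : ℝ} (h : DiscChain Ω x y L) : ∃ γ, IsTamePath Ω x y L γ := by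
  induction h with
  | single hs => exact hs.exists_isTamePath hb
  | cons hs _ ih =>
    obtain ⟨γ, hγ⟩ := hs.exists_isTamePath hb
    obtain ⟨γ', hγ'⟩ := ih
    exact hγ.trans ho hc hγ'

/-! ### Summation along geometric scales. -/

theorem summable_comp_geometric {M : ℝ → ℝ} (hM : Monotone M) (h0 : ∀ r, 0 ≤ M r) {ε : ℝ}
    (hε : 0 < ε) (hint : MeasureTheory.IntegrableOn (fun r : ℝ => 1 / r * M r) (Set.Ioc 0 ε))
    {A q : ℝ} (hA : 0 < A) (hq : 0 < q) (hq1 : q < 1) : Summable fun k : ℕ => M (A * q ^ k) := by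
  have hlim : Tendsto (fun k : ℕ => A * q ^ k) atTop (𝓝 0) := by
    simpa using (tendsto_pow_atTop_nhds_zero_of_lt_one hq.le hq1).const_mul A
  obtain ⟨k₀, hk₀⟩ := (hlim.eventually_lt_const hε).exists
  set a : ℕ → ℝ := fun k => A * q ^ (k₀ + k) with ha
  have hpos : ∀ k, 0 < a k := fun k => by positivity
  have hsucc : ∀ k, a (k + 1) = q * a k := fun k => by simp only [ha]; ring
  have hanti : Antitone a := antitone_nat_of_succ_le fun k => by
    rw [hsucc]; nlinarith [hpos k]
  have hsub : ∀ k, Set.Ioc (a (k + 1)) (a k) ⊆ Set.Ioc 0 ε := fun k r hr =>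
    ⟨(hpos _).trans hr.1, hr.2.trans ((hanti k.zero_le).trans hk₀.le)⟩
  have hsum := (MeasureTheory.hasSum_integral_iUnion (fun k => measurableSet_Ioc)
    hanti.pairwise_disjoint_on_Ioc_succ
    (hint.mono_set (Set.iUnion_subset hsub))).summable
  -- The shell has length `(1 - q) * a k`, and on it `1 / r ≥ 1 / a k` and `M r ≥ M (a (k + 1))`.
  have hle : ∀ k, (1 - q) * M (a (k + 1)) ≤ ∫ r in Set.Ioc (a (k + 1)) (a k), 1 / r * M r := by
    intro k
    have h1 := MeasureTheory.setIntegral_mono_on (μ := MeasureTheory.volume)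
      (f := fun _ : ℝ => 1 / a k * M (a (k + 1)))
      (MeasureTheory.integrableOn_const (by simp)) (hint.mono_set (hsub k)) measurableSet_Ioc
      (fun r hr => by
        have hr0 : 0 < r := (hpos _).trans hr.1
        exact mul_le_mul (one_div_le_one_div_of_le hr0 hr.2) (hM hr.1.le) (h0 _) (by positivity))
    refine le_trans (le_of_eq ?_) h1
    rw [MeasureTheory.setIntegral_const, smul_eq_mul, Real.volume_real_Ioc_of_le (hanti k.le_succ),
      hsucc]
    have := (hpos k).ne'
    field_simp
  have hs1 : Summable fun k => (1 - q) * M (a (k + 1)) :=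
    Summable.of_nonneg_of_le (fun k => mul_nonneg (by linarith) (h0 _)) hle hsum
  rw [summable_mul_left_iff (by linarith)] at hs1
  rw [← summable_nat_add_iff (k₀ + 1)]
  refine hs1.congr fun k => ?_
  change M (A * q ^ (k₀ + (k + 1))) = _
  rw [add_left_comm]

/-- Dominated convergence as the cap `A * q ^ j` tends to `0`: each capped term is at most `M (A * q
^ j)`, which tends to `0` by summability. -/
theorem exists_sum_comp_min_lt {M : ℝ → ℝ} (hM : Monotone M) (h0 : ∀ r, 0 ≤ M r)
    {A q : ℝ} (hA : 0 < A) (hq : 0 < q) (hs : Summable fun k : ℕ => M (A * q ^ k)) {c : ℝ}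
    (hc : 0 < c) : ∃ ε > 0, ∀ N : ℕ, ∑ k ∈ Finset.range N, M (min (A * q ^ k) ε) < c := by
  have hle : ∀ j k : ℕ, M (min (A * q ^ k) (A * q ^ j)) ≤ M (A * q ^ k) :=
    fun j k => hM (min_le_left _ _)
  have hlim : Tendsto (fun j : ℕ => ∑' k : ℕ, M (min (A * q ^ k) (A * q ^ j))) atTop
      (𝓝 (∑' _ : ℕ, (0 : ℝ))) := by
    refine tendsto_tsum_of_dominated_convergence hs (fun k => ?_) (.of_forall fun j k => ?_)
    · exact squeeze_zero (fun j => h0 _) (fun j => hM (min_le_right _ _)) hs.tendsto_atTop_zero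
    · rw [Real.norm_of_nonneg (h0 _)]
      exact hle j k
  rw [tsum_zero] at hlim
  obtain ⟨j, hj⟩ := (hlim.eventually_lt_const hc).exists
  refine ⟨A * q ^ j, by positivity, fun N => lt_of_le_of_lt ?_ hj⟩
  exact (Summable.of_nonneg_of_le (fun k => h0 _) (hle j) hs).sum_le_tsum _ fun k _ => h0 _

theorem norm_sub_le_sum_of_unit_steps {E : Type*} [SeminormedAddCommGroup E] {g : ℝ → E} {ℓ : ℝ}
    {b : ℕ → ℝ} (hb : ∀ k, 0 ≤ b k)
    (h : ∀ (k : ℕ) (s t : ℝ), k ≤ s → s ≤ t → t ≤ k + 1 → t ≤ ℓ → ‖g t - g s‖ ≤ b k) (N : ℕ)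
    {t : ℝ} (ht : 0 ≤ t) (htℓ : t ≤ ℓ) (htN : t ≤ N) :
    ‖g t - g 0‖ ≤ ∑ k ∈ Finset.range N, b k := by
  induction N generalizing t with
  | zero =>
    obtain rfl : t = 0 := le_antisymm (by simpa using htN) ht
    simp
  | succ N ih =>
    rw [Finset.sum_range_succ]
    rcases le_total t N with hN | hN
    · exact (ih ht htℓ hN).trans (le_add_of_nonneg_right (hb N))
    · rw [add_comm]
      exact (norm_sub_le_norm_sub_add_norm_sub _ (g N) _).trans (add_le_add
        (h N N t le_rfl hN (by exact_mod_cast htN) htℓ)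
        (ih N.cast_nonneg (hN.trans htℓ) le_rfl))

/-! ### Visibility and the bound on the Gromov product. -/

theorem boundaryDist_pos (ho : IsOpen Ω) (hf : (frontier Ω).Nonempty) (hx : x ∈ Ω) :
    0 < boundaryDist Ω x := by
  refine (isClosed_frontier.notMem_iff_infDist_pos hf).mp fun h => ?_
  rw [ho.frontier_eq] at h
  exact h.2 hx

/-- Visibility: an almost length-minimizing tame path between distant points of a Goldilocks
domain passes far from the boundary. -/
theorem IsGoldilocks.exists_le_boundaryDist (hΩ : IsGoldilocks Ω) (hf : (frontier Ω).Nonempty)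
    {c : ℝ} (hc : 0 < c) :
    ∃ ε > 0, ∀ x y L γ, IsTamePath Ω x y L γ → L ≤ kobayashiDist Ω x y + 1 → c ≤ ‖x - y‖ →
      ∃ t, 0 ≤ t ∧ t ≤ L ∧ ε ≤ boundaryDist Ω (γ t) := by
  obtain ⟨o, ho⟩ := hΩ.isConnected.nonempty
  obtain ⟨C, hC, α, hα, hKle⟩ := hΩ.dist_le o ho
  obtain ⟨ε', hε', hint⟩ := hΩ.integrable_growth
  have hM := kobayashiGrowth_mono hΩ.isBounded
  have h0 : ∀ r, 0 ≤ kobayashiGrowth Ω r := kobayashiGrowth_nonneg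
  -- Solving `k - 1 ≤ 2 * C + 2 * α * log (1 / δ)` for `δ` gives `δ ≤ A * q ^ k`.
  set A := Real.exp ((2 * C + 1) / (2 * α)) with hA
  set q := Real.exp (-(1 / (2 * α))) with hq
  have hq0 : 0 < q := Real.exp_pos _
  have hq1 : q < 1 := Real.exp_lt_one_iff.mpr (neg_lt_zero.mpr (by positivity))
  obtain ⟨ε, hε, hsum⟩ := exists_sum_comp_min_lt hM h0 (Real.exp_pos _) hq0
    (summable_comp_geometric hM h0 hε' hint (Real.exp_pos _) hq0 hq1) (half_pos hc)
  rw [← hA] at hsum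
  refine ⟨ε, hε, fun x y L γ h hL hxy => ?_⟩
  by_contra! hlt
  have hL0 := h.nonneg
  have htri : ∀ {u v w : EuclideanSpace ℂ (Fin d)}, u ∈ Ω → v ∈ Ω → w ∈ Ω →
      kobayashiDist Ω u w ≤ kobayashiDist Ω u v + kobayashiDist Ω v w :=
    kobayashiDist_triangle hΩ.isOpen hΩ.isConnected.isPreconnected
  have hx : x ∈ Ω := h.source ▸ h.mem 0 le_rfl hL0
  have hy : y ∈ Ω := h.target ▸ h.mem L hL0 le_rfl
  -- Subpaths inherit the total defect `1`, since the two outer pieces are no shorter than the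
  -- distances between their ends.
  have halmost : ∀ s t, 0 ≤ s → s ≤ t → t ≤ L → t - s - 1 ≤ kobayashiDist Ω (γ s) (γ t) := by
    intro s t hs hst ht
    have h1 := h.dist_le 0 s le_rfl hs (hst.trans ht)
    have h2 := h.dist_le t L (hs.trans hst) ht le_rfl
    rw [h.source] at h1
    rw [h.target] at h2
    have hms := h.mem s hs (hst.trans ht)
    have hmt := h.mem t (hs.trans hst) ht
    linarith [htri hx hms hy, htri hms hmt hy]
  have hcont : ContinuousOn γ (Set.Icc 0 L) := by
    refine (LipschitzOnWith.of_dist_le_mul (K := ⟨kobayashiGrowth Ω ε, h0 ε⟩)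
      fun s hs t ht => ?_).continuousOn
    change dist (γ s) (γ t) ≤ kobayashiGrowth Ω ε * dist s t
    have key : ∀ s t, 0 ≤ s → s ≤ t → t ≤ L →
        dist (γ t) (γ s) ≤ kobayashiGrowth Ω ε * dist t s := fun s t hs hst ht => by
      rw [dist_eq_norm, Real.dist_eq, abs_of_nonneg (sub_nonneg.mpr hst)]
      exact h.speed s t ε hs hst ht fun u hsu hut => (hlt u (hs.trans hsu) (hut.trans ht)).le
    rcases le_total s t with hst | hst
    · rw [dist_comm, dist_comm s]; exact key s t hs.1 hst ht.2
    · exact key t s ht.1 hst hs.2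
  obtain ⟨T, hT, hmax⟩ := isCompact_Icc.exists_isMaxOn (Set.nonempty_Icc.mpr hL0)
    ((Metric.continuous_infDist_pt (frontier Ω)).comp_continuousOn hcont)
  have hdecay : ∀ (k : ℕ) (t : ℝ), 0 ≤ t → t ≤ L → k ≤ |t - T| →
      boundaryDist Ω (γ t) ≤ min (A * q ^ k) ε := by
    intro k t ht0 htL hk
    refine le_min ?_ (hlt t ht0 htL).le
    have hmt := h.mem t ht0 htL
    have hmT := h.mem T hT.1 hT.2
    have hpos := boundaryDist_pos hΩ.isOpen hf hmt
    have hposT := boundaryDist_pos hΩ.isOpen hf hmT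
    have h1 : |t - T| - 1 ≤ kobayashiDist Ω (γ t) (γ T) := by
      rcases le_total t T with htT | htT
      · rw [abs_of_nonpos (by linarith)]
        linarith [halmost t T ht0 htT hT.2]
      · rw [abs_of_nonneg (by linarith), kobayashiDist_comm]
        exact halmost T t hT.1 htT htL
    have h2 := htri hmt ho hmT
    rw [kobayashiDist_comm Ω (γ t) o] at h2
    have h3 := hKle _ hmt
    -- Maximality of `δ` at `T` lets the logarithm at `γ T` be replaced by the larger one at `γ t`;
    -- hence the factor `2 * α`.
    have h4 := hKle _ hmT
    have h5 : Real.log (1 / boundaryDist Ω (γ T)) ≤ Real.log (1 / boundaryDist Ω (γ t)) :=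
      Real.log_le_log (by positivity) (one_div_le_one_div_of_le hpos (hmax ⟨ht0, htL⟩))
    have h6 : Real.log (1 / boundaryDist Ω (γ t)) = -Real.log (boundaryDist Ω (γ t)) := by
      rw [one_div, Real.log_inv]
    have h7 := mul_le_mul_of_nonneg_left h5 hα.le
    rw [h6] at h3 h7
    rw [hA, hq, ← Real.exp_nat_mul, ← Real.exp_add, ← Real.log_le_iff_le_exp hpos]
    have : (2 * C + 1) / (2 * α) + k * -(1 / (2 * α)) = (2 * C + 1 - k) / (2 * α) := by ring
    rw [this, le_div_iff₀ (by positivity)]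
    linarith
  -- Time after `T` is cut into unit intervals; on the `k`-th one `|u - T| ≥ k`, so `hdecay` bounds
  -- the speed there. `hleft` runs the same argument backwards from `T`.
  have hright : ‖γ (T + (L - T)) - γ (T + 0)‖ < c / 2 := by
    refine lt_of_le_of_lt ?_ (hsum ⌈L - T⌉₊)
    refine norm_sub_le_sum_of_unit_steps (g := fun u => γ (T + u)) (fun k => h0 _)
      (fun k s t hs hst ht htL => ?_) _ (sub_nonneg.mpr hT.2) le_rfl (Nat.le_ceil _)
    have hk : (0 : ℝ) ≤ k := k.cast_nonneg
    refine (h.speed (T + s) (T + t) (min (A * q ^ k) ε) (by linarith [hT.1]) (by linarith)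
      (by linarith) fun u hsu hut => hdecay k u (by linarith [hT.1]) (by linarith) ?_).trans ?_
    · exact le_trans (by linarith) (le_abs_self _)
    · exact mul_le_of_le_one_right (h0 _) (by linarith)
  have hleft : ‖γ (T - T) - γ (T - 0)‖ < c / 2 := by
    refine lt_of_le_of_lt ?_ (hsum ⌈T⌉₊)
    refine norm_sub_le_sum_of_unit_steps (g := fun u => γ (T - u)) (fun k => h0 _)
      (fun k s t hs hst ht htL => ?_) _ hT.1 le_rfl (Nat.le_ceil _)
    have hk : (0 : ℝ) ≤ k := k.cast_nonneg
    rw [norm_sub_rev]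
    refine (h.speed (T - t) (T - s) (min (A * q ^ k) ε) (by linarith) (by linarith)
      (by linarith [hT.2]) fun u hsu hut => hdecay k u (by linarith) (by linarith [hT.2]) ?_).trans ?_
    · exact le_trans (by linarith) (neg_le_abs _)
    · exact mul_le_of_le_one_right (h0 _) (by linarith)
  rw [add_zero, add_sub_cancel, h.target, norm_sub_rev] at hright
  rw [sub_zero, sub_self, h.source, norm_sub_rev, norm_sub_rev] at hleft
  linarith [norm_sub_le_norm_sub_add_norm_sub x (γ T) y]

/-- In a Goldilocks domain the Gromov product is bounded on pairs of points at Euclidean distance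
at least `c`. -/
theorem IsGoldilocks.exists_gromovProduct_le (hΩ : IsGoldilocks Ω) (hf : (frontier Ω).Nonempty)
    {o : EuclideanSpace ℂ (Fin d)} (ho : o ∈ Ω) {c : ℝ} (hc : 0 < c) :
    ∃ B : ℝ, ∀ x ∈ Ω, ∀ y ∈ Ω, c ≤ ‖x - y‖ → gromovProduct (kobayashiDist Ω) x y o ≤ B := by
  obtain ⟨ε, hε, hvis⟩ := hΩ.exists_le_boundaryDist hf hc
  obtain ⟨C, hC, α, hα, hKle⟩ := hΩ.dist_le o ho
  have hpre := hΩ.isConnected.isPreconnected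
  -- For `p = γ t` with `δ(p) ≥ ε`, the triangle inequality at `p` gives `K(x,o) + K(o,y) ≤ L + 2
  -- K(o,p)`. The term `1/2` is half the defect in `L < K(x,y) + 1`.
  refine ⟨C + α * Real.log (1 / ε) + 1 / 2, fun x hx y hy hxy => ?_⟩
  obtain ⟨L, hL, hchain⟩ := exists_discChain_lt hΩ.isOpen hpre hx hy (lt_add_one _)
  obtain ⟨γ, h⟩ := hchain.exists_isTamePath hΩ.isOpen hpre hΩ.isBounded
  obtain ⟨t, ht0, htL, ht⟩ := hvis x y L γ h hL.le hxy
  have hmt := h.mem t ht0 htL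
  have h1 := h.dist_le 0 t le_rfl ht0 htL
  have h2 := h.dist_le t L ht0 htL le_rfl
  rw [h.source] at h1
  rw [h.target] at h2
  have h3 := kobayashiDist_triangle hΩ.isOpen hpre hx hmt ho
  have h4 := kobayashiDist_triangle hΩ.isOpen hpre ho hmt hy
  rw [kobayashiDist_comm Ω (γ t) o] at h3
  have h5 := hKle _ hmt
  have h6 : Real.log (1 / boundaryDist Ω (γ t)) ≤ Real.log (1 / ε) :=
    Real.log_le_log (one_div_pos.mpr (hε.trans_le ht)) (one_div_le_one_div_of_le hε ht)
  have h7 := mul_le_mul_of_nonneg_left h6 hα.le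
  rw [gromovProduct]
  linarith

end

theorem proposition5 {d : ℕ} (Ω : Set (EuclideanSpace ℂ (Fin d))) (hΩ : IsGoldilocks Ω)
    (x y : ℕ → EuclideanSpace ℂ (Fin d)) (hx : ∀ n, x n ∈ Ω) (hy : ∀ n, y n ∈ Ω)
    (ξ η : EuclideanSpace ℂ (Fin d)) (hξ : ξ ∈ frontier Ω) (hη : η ∈ frontier Ω)
    (hxξ : Tendsto x atTop (𝓝 ξ)) (hyη : Tendsto y atTop (𝓝 η)) (hne : ξ ≠ η)
    (o : EuclideanSpace ℂ (Fin d)) (ho : o ∈ Ω) :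
    limsup (fun p : ℕ × ℕ =>
        ((gromovProduct (kobayashiDist Ω) (x p.1) (y p.2) o : ℝ) : EReal))
      (atTop ×ˢ atTop) < ⊤ := by
  have hpos : 0 < ‖ξ - η‖ := norm_pos_iff.mpr (sub_ne_zero.mpr hne)
  obtain ⟨B, hB⟩ := hΩ.exists_gromovProduct_le ⟨ξ, hξ⟩ ho (half_pos hpos)
  -- Eventually `‖x n - y m‖` exceeds `‖ξ - η‖ / 2`, the separation for which `B` was obtained.
  refine lt_of_le_of_lt (b := (B : EReal)) (limsup_le_of_le (h := ?_)) (EReal.coe_lt_top B)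
  have hlim : Tendsto (fun p : ℕ × ℕ => ‖x p.1 - y p.2‖) (atTop ×ˢ atTop) (𝓝 ‖ξ - η‖) :=
    ((hxξ.comp tendsto_fst).sub (hyη.comp tendsto_snd)).norm
  filter_upwards [hlim.eventually_const_lt (half_lt_self hpos)] with p hp
  exact EReal.coe_le_coe_iff.mpr (hB _ (hx _) _ (hy _) hp.le)
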